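/- **Theorem (approximate Ramsey property of matrix algebras over a finite field).** Let $q$ be a prime power and $\mathbb F_q$ the field with $q$ elements. For $n\ge 1$ equip $M_n(\mathbb F_q)$ with the normalized rank metric $d(x,y)=\operatorname{rank}(x-y)/n$. For $A=M_a(\mathbb F_q)$ and $D=M_n(\mathbb F_q)$, let $\binom{D}{A}$ be the set of unital $\mathbb F_q$-subalgebras of $D$ isomorphic to $A$, with the metric $$d(A_1,A_2)=\min_{e}\ \max_{x\in A_1} d(x,e(x)),$$ where $e$ ranges over the $\mathbb F_q$-algebra isomorphisms $A_1\to A_2$; for $B'\in\binom{D}{B}$ let $\binom{B'}{A}$ be the set of those $A'\in\binom{D}{A}$ with $A'\subseteq B'$. Let $a,b\ge 1$, $A=M_a(\mathbb F_q)$, $B=M_b(\mathbb F_q)$, and $\varepsilon>0$. For $c\ge 1$ and $C=M_c(\mathbb F_q)$ consider the property $(\mathrm R_c)$ for every $1$-Lipschitz map $\gamma:\binom{C}{A}\to[0,1]$ there is $B'\in\binom{C}{B}$ such that the oscillation $\sup\{|\gamma(A_1)-\gamma(A_2)| : A_1,A_2\in\binom{B'}{A}\}$ is at most $\varepsilon$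 (the supremum of the empty set being $0$). Then: 1. There is $c\ge 1$ for which $(\mathrm R_c)$ holds. 2. Suppose moreover that $a\mid b$, and put $k=\left|\binom{B}{A}\right|$. - $(\mathrm R_c)$ holds for every multiple $c$ of $b$ with $$c>64\,\varepsilon^{-2}\max\{\log(2k),\ \log(6\lceil\varepsilon^{-1}\rceil)\}.$$ - $k\le q^{b^2}$, and hence $$64\,\varepsilon^{-2}\max\{\log(2k),\log(6\lceil\varepsilon^{-1}\rceil)\}\ \le\ 64\,\varepsilon^{-2}\bigl(\log 2+\max\{b^2\log q,\ \log(6\lceil\varepsilon^{-1}\rceil)\}\bigr);$$ in particular $(\mathrm R_c)$ holds for every multiple $c$ of $b$ exceeding the right-hand side. -/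

import Mathlib

namespace MatrixRamsey

/-- The normalized rank metric `d(x, y) = rank (x - y) / n` on `M_n(F)`. -/
noncomputable def rankDist {F : Type*} [Field F] {n : ℕ}
    (x y : Matrix (Fin n) (Fin n) F) : ℝ :=
  ((x - y).rank : ℝ) / n

/-- The set of copies of `M_a(F)` in `M_n(F)`: the (unital) `F`-subalgebras of `M_n(F)` that are
isomorphic to `M_a(F)`. -/
structure Copies (F : Type*) [Field F] (a n : ℕ) where
  /-- The underlying subalgebra. -/
  alg : Subalgebra F (Matrix (Fin n) (Fin n) F)
  isCopy : Nonempty (Matrix (Fin a) (Fin a) F ≃ₐ[F] alg)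

/-- The distance between two copies: the infimum, over all algebra isomorphisms `e : S ≃ T`,
of the uniform distance `sup_{x ∈ S} d(x, e x)`. Equivalently, the infimum of the uniform
distances between embeddings of `M_a(F)` with images `S` and `T`. -/
noncomputable def copyDist {F : Type*} [Field F] {a n : ℕ} (S T : Copies F a n) : ℝ :=
  ⨅ e : S.alg ≃ₐ[F] T.alg, ⨆ x : S.alg, rankDist (x : Matrix (Fin n) (Fin n) F) (e x)

theorem rankDist_nonneg {F : Type*} [Field F] {n : ℕ} (x y : Matrix (Fin n) (Fin n) F) :
    0 ≤ rankDist x y := by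
  unfold rankDist; positivity

theorem rankDist_self {F : Type*} [Field F] {n : ℕ} (x : Matrix (Fin n) (Fin n) F) :
    rankDist x x = 0 := by
  simp [rankDist]

theorem rankDist_comm {F : Type*} [Field F] {n : ℕ} (x y : Matrix (Fin n) (Fin n) F) :
    rankDist x y = rankDist y x := by
  unfold rankDist
  have h : (x - y).rank = (y - x).rank := by
    apply le_antisymm
    · have := Matrix.rank_mul_le_left (y - x) (-1 : Matrix (Fin n) (Fin n) F)
      simpa using this
    · have := Matrix.rank_mul_le_left (x - y) (-1 : Matrix (Fin n) (Fin n) F)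
      simpa using this
  rw [h]

theorem rank_add_le {F : Type*} [Field F] {n : ℕ} (x y : Matrix (Fin n) (Fin n) F) :
    (x + y).rank ≤ x.rank + y.rank := by
  unfold Matrix.rank
  rw [Matrix.mulVecLin_add]
  exact (Submodule.finrank_mono (LinearMap.range_add_le _ _)).trans
    (Submodule.finrank_add_le_finrank_add_finrank _ _)

theorem rankDist_triangle {F : Type*} [Field F] {n : ℕ} (x y z : Matrix (Fin n) (Fin n) F) :
    rankDist x z ≤ rankDist x y + rankDist y z := by
  unfold rankDist
  rw [← add_div]
  gcongr
  have := rank_add_le (x - y) (y - z)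
  rw [sub_add_sub_cancel] at this
  exact_mod_cast this

theorem eq_of_rankDist_eq_zero {F : Type*} [Field F] {n : ℕ} {x y : Matrix (Fin n) (Fin n) F}
    (h : rankDist x y = 0) : x = y := by
  rcases Nat.eq_zero_or_pos n with rfl | hn
  · exact Subsingleton.elim _ _
  · unfold rankDist at h
    have hn' : (n : ℝ) ≠ 0 := by positivity
    have h2 : (x - y).rank = 0 := by
      rcases div_eq_zero_iff.1 h with h | h
      · exact_mod_cast h
      · exact absurd h hn'
    have h3 : LinearMap.range (x - y).mulVecLin = ⊥ := Submodule.finrank_eq_zero.1 h2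
    rw [LinearMap.range_eq_bot] at h3
    refine sub_eq_zero.1 (Matrix.mulVec_injective ?_)
    funext v
    have := LinearMap.congr_fun h3 v
    rw [Matrix.mulVecLin_apply] at this
    rw [this, Matrix.zero_mulVec, LinearMap.zero_apply]

theorem Copies.alg_injective {F : Type*} [Field F] {a n : ℕ} {S T : Copies F a n}
    (h : S.alg = T.alg) : S = T := by
  cases S; cases T; cases h; rfl

/-- Over a finite field there are finitely many copies. -/
instance {F : Type*} [Field F] [Finite F] {a n : ℕ} : Finite (Copies F a n) :=
  Finite.of_injective
    (fun S : Copies F a n => (S.alg : Set (Matrix (Fin n) (Fin n) F)))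
    fun _ _ h => Copies.alg_injective (SetLike.coe_injective h)

theorem Copies.nonempty_algEquiv {F : Type*} [Field F] {a n : ℕ} (S T : Copies F a n) :
    Nonempty (S.alg ≃ₐ[F] T.alg) :=
  ⟨S.isCopy.some.symm.trans T.isCopy.some⟩

/-- Over a finite field the infimum and supremum in `copyDist` run over finite sets. -/
theorem exists_copyDist_eq {F : Type*} [Field F] [Finite F] {a n : ℕ} (S T : Copies F a n) :
    ∃ e : S.alg ≃ₐ[F] T.alg, copyDist S T =
      ⨆ x : S.alg, rankDist (x : Matrix (Fin n) (Fin n) F) (e x) := by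
  have := Copies.nonempty_algEquiv S T
  have : Finite (S.alg ≃ₐ[F] T.alg) := DFunLike.finite _
  obtain ⟨e, he⟩ := exists_eq_ciInf_of_finite
    (f := fun e : S.alg ≃ₐ[F] T.alg => ⨆ x : S.alg, rankDist (x : Matrix (Fin n) (Fin n) F) (e x))
  exact ⟨e, he.symm⟩

theorem rankDist_le_iSup {F : Type*} [Field F] [Finite F] {a n : ℕ} {S T : Copies F a n}
    (e : S.alg ≃ₐ[F] T.alg) (x : S.alg) :
    rankDist (x : Matrix (Fin n) (Fin n) F) (e x) ≤
      ⨆ x : S.alg, rankDist (x : Matrix (Fin n) (Fin n) F) (e x) :=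
  le_ciSup (f := fun x : S.alg => rankDist (x : Matrix (Fin n) (Fin n) F) (e x))
    (Set.finite_range _).bddAbove x

theorem copyDist_le {F : Type*} [Field F] [Finite F] {a n : ℕ} {S T : Copies F a n}
    (e : S.alg ≃ₐ[F] T.alg) {r : ℝ}
    (h : ∀ x : S.alg, rankDist (x : Matrix (Fin n) (Fin n) F) (e x) ≤ r) : copyDist S T ≤ r := by
  have : Finite (S.alg ≃ₐ[F] T.alg) := DFunLike.finite _
  exact (ciInf_le (Set.finite_range _).bddBelow e).trans (ciSup_le h)

theorem copyDist_comm_le {F : Type*} [Field F] [Finite F] {a n : ℕ} (S T : Copies F a n) :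
    copyDist T S ≤ copyDist S T := by
  obtain ⟨e, he⟩ := exists_copyDist_eq S T
  rw [he]
  refine copyDist_le e.symm fun y => ?_
  have := rankDist_le_iSup e (e.symm y)
  rw [e.apply_symm_apply, rankDist_comm] at this
  exact this

/-- `Copies F a n` as a metric space, with the distance `copyDist`. -/
noncomputable instance {F : Type*} [Field F] [Finite F] {a n : ℕ} :
    MetricSpace (Copies F a n) where
  dist := copyDist
  dist_self S := by
    apply le_antisymm
    · exact copyDist_le AlgEquiv.refl fun x => by simp [rankDist_self]
    · exact Real.iInf_nonneg fun e => Real.iSup_nonneg fun x => rankDist_nonneg _ _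
  dist_comm S T := le_antisymm (copyDist_comm_le T S) (copyDist_comm_le S T)
  dist_triangle S T U := by
    obtain ⟨e, he⟩ := exists_copyDist_eq S T
    obtain ⟨f, hf⟩ := exists_copyDist_eq T U
    rw [he, hf]
    refine copyDist_le (e.trans f) fun x => ?_
    exact (rankDist_triangle _ (e x : Matrix (Fin n) (Fin n) F) _).trans
      (add_le_add (rankDist_le_iSup e x) (rankDist_le_iSup f (e x)))
  eq_of_dist_eq_zero := by
    intro S T h
    obtain ⟨e, he⟩ := exists_copyDist_eq S T
    have h0 : ∀ x : S.alg, (x : Matrix (Fin n) (Fin n) F) = e x := fun x =>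
      eq_of_rankDist_eq_zero (le_antisymm
        ((rankDist_le_iSup e x).trans (he.symm.trans h).le) (rankDist_nonneg _ _))
    refine Copies.alg_injective (SetLike.ext fun m => ⟨fun hm => ?_, fun hm => ?_⟩)
    · have h1 : m = e ⟨m, hm⟩ := h0 ⟨m, hm⟩
      rw [h1]
      exact (e ⟨m, hm⟩).2
    · have := h0 (e.symm ⟨m, hm⟩)
      rw [e.apply_symm_apply] at this
      have h1 : (e.symm ⟨m, hm⟩ : Matrix (Fin n) (Fin n) F) = m := this
      rw [← h1]
      exact (e.symm ⟨m, hm⟩).2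

/-- For `B'` a copy of `M_b(F)` in `M_n(F)`, the set of copies of `M_a(F)` inside `B'`. -/
def copiesIn {F : Type*} [Field F] (a : ℕ) {b n : ℕ} (B' : Copies F b n) : Set (Copies F a n) :=
  {A' | A'.alg ≤ B'.alg}

/-- The oscillation `sup_{x, y ∈ s} |γ x - γ y|` of a `[0,1]`-valued function on `s`. -/
noncomputable def oscillation {X : Type*} (γ : X → unitInterval) (s : Set X) : ℝ :=
  Metric.diam (γ '' s)

/-- `M_c(F)` witnesses the approximate Ramsey property for `M_a(F)`, `M_b(F)` and `ε`: every
`1`-Lipschitz colouring of the copies of `M_a(F)` in `M_c(F)` has oscillation at most `ε` on the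
copies of `M_a(F)` inside some copy of `M_b(F)` in `M_c(F)`. -/
def ApproxRamsey (F : Type*) [Field F] [Finite F] (a b c : ℕ) (ε : ℝ) : Prop :=
  ∀ γ : Copies F a c → unitInterval, LipschitzWith 1 γ →
    ∃ B' : Copies F b c, oscillation γ (copiesIn a B') ≤ ε

/-- `64 ε⁻² max {log (2k), log (6⌈ε⁻¹⌉)}`, with `k` the number of copies of `M_a(F)` in
`M_b(F)`. -/
noncomputable def ramseyBound (F : Type*) [Field F] (a b : ℕ) (ε : ℝ) : ℝ :=
  64 * (ε ^ 2)⁻¹ *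
    max (Real.log (2 * (Nat.card (Copies F a b) : ℝ))) (Real.log (6 * (⌈ε⁻¹⌉₊ : ℝ)))

/-- `64 ε⁻² (log 2 + max {b² log q, log (6⌈ε⁻¹⌉)})`, with `q = |F|`. -/
noncomputable def explicitBound (F : Type*) [Field F] (b : ℕ) (ε : ℝ) : ℝ :=
  64 * (ε ^ 2)⁻¹ *
    (Real.log 2 + max ((b : ℝ) ^ 2 * Real.log (Nat.card F : ℝ)) (Real.log (6 * (⌈ε⁻¹⌉₊ : ℝ))))

end MatrixRamsey

/-! The copy of $B$ is found at random. Fix an embedding $f : B \to C$, which exists when $b \mid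
c$, and conjugate it by a uniform $g \in GL_c(\mathbb F_q)$. By Skolem–Noether
(`exists_unit_mul_eq`), conjugation is transitive on copies of $A$ in $C$, so the mean of
$\gamma(gSg^{-1})$ over $g$ is the same for every copy $S$ (`sum_conj_eq`). If, for a single $g$,
all $k$ copies inside $f(B)$ have values within $\varepsilon/2$ of this mean, then $g f(B) g^{-1}$
has oscillation at most $\varepsilon$.

Such a $g$ exists by concentration of measure on $GL_c$ and a union bound. Concentration comes from
the stabilizers of the first $i$ basis vectors, a chain from $GL_c$ to the trivial group with $c$
steps (`card_abs_tail_le_of_rank`). Two cosets of one stabilizer inside a coset of the previous one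
are matched by left multiplication by some $u$ with $\operatorname{rank}(u-1)\le 1$
(`exists_unit_of_basisStabilizer`). Conjugation by such a $u$ moves a copy by at most $2/c$
(`Copies.dist_conj_le`), so averages of $\gamma$ vary by at most $2/c$ per step. This yields a
subgaussian tail $2\exp(-\varepsilon^2c/32)$.

If $a \nmid b$, there are no copies of $A$ in $B$, and $c=b$ works trivially. -/

namespace MatrixRamsey

/-! ### Exponential moments and concentration along a chain of subgroups -/

/-- Exponential moment bound for a function of small oscillation on a finite set. -/
theorem sum_exp_le_of_abs_sub_le {ι : Type*} [Fintype ι] [Nonempty ι] (φ : ι → ℝ) {w : ℝ}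
    (hw : ∀ i j, |φ i - φ j| ≤ w) :
    ∑ i, Real.exp (φ i) ≤
      Fintype.card ι * Real.exp (w ^ 2 / 2) * Real.exp ((∑ i, φ i) / Fintype.card ι) := by
  obtain ⟨n, hn⟩ : ∃ n : ℝ, n = Fintype.card ι := ⟨_, rfl⟩
  have hn0 : 0 < n := by rw [hn]; exact_mod_cast Fintype.card_pos
  rw [← hn]
  set m : ℝ := (∑ i, φ i) / n with hm
  have hsum : ∑ i, φ i = n * m := by rw [hm]; field_simp
  -- Jensen's inequality, from the tangent line of exp at $-m$. It lets an independent copy of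
  -- $\varphi$ stand in for the mean $m$.
  have hjensen : n * Real.exp (-m) ≤ ∑ j, Real.exp (-φ j) := by
    calc n * Real.exp (-m) = ∑ j, Real.exp (-m) * (m - φ j + 1) := by
          rw [← Finset.mul_sum, Finset.sum_add_distrib, Finset.sum_sub_distrib, hsum,
            Finset.sum_const, Finset.sum_const, Finset.card_univ, nsmul_eq_mul, nsmul_eq_mul, ← hn]
          ring
      _ ≤ ∑ j, Real.exp (-φ j) := by
          refine Finset.sum_le_sum fun j _ => ?_
          calc Real.exp (-m) * (m - φ j + 1) ≤ Real.exp (-m) * Real.exp (m - φ j) := by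
                gcongr; exact Real.add_one_le_exp _
            _ = Real.exp (-φ j) := by rw [← Real.exp_add]; congr 1; ring
  have hpair : ∑ i, ∑ j, Real.exp (φ i - φ j) ≤ n * (n * Real.exp (w ^ 2 / 2)) := by
    -- Swapping $i$ and $j$ turns exp into cosh; the odd terms cancel, leaving a bound quadratic in
    -- $w$.
    have hswap : ∑ i, ∑ j, Real.exp (φ i - φ j) = ∑ i, ∑ j, Real.cosh (φ i - φ j) := by
      have h1 : ∑ i, ∑ j, Real.exp (φ i - φ j) = ∑ i, ∑ j, Real.exp (-(φ i - φ j)) := by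
        rw [Finset.sum_comm]
        simp
      simp only [Real.cosh_eq, ← Finset.sum_div, Finset.sum_add_distrib, ← h1]
      ring
    rw [hswap]
    calc ∑ i, ∑ j, Real.cosh (φ i - φ j) ≤ ∑ _i : ι, ∑ _j : ι, Real.exp (w ^ 2 / 2) := by
          refine Finset.sum_le_sum fun i _ => Finset.sum_le_sum fun j _ => ?_
          refine (Real.cosh_le_exp_half_sq _).trans (Real.exp_le_exp.2 ?_)
          have := sq_le_sq' (abs_le.1 (hw i j)).1 (abs_le.1 (hw i j)).2
          linarith
      _ = n * (n * Real.exp (w ^ 2 / 2)) := by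
          rw [Finset.sum_const, Finset.sum_const, Finset.card_univ, nsmul_eq_mul, nsmul_eq_mul, ← hn]
  have hkey : (∑ i, Real.exp (φ i)) * (n * Real.exp (-m)) ≤ n * (n * Real.exp (w ^ 2 / 2)) := by
    calc _ ≤ (∑ i, Real.exp (φ i)) * ∑ j, Real.exp (-φ j) :=
          mul_le_mul_of_nonneg_left hjensen (Finset.sum_nonneg fun i _ => (Real.exp_pos _).le)
      _ = ∑ i, ∑ j, Real.exp (φ i - φ j) := by
          simp only [Finset.sum_mul_sum, ← Real.exp_add, sub_eq_add_neg]
      _ ≤ _ := hpair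
  clear_value m
  clear hsum hm
  rw [Real.exp_neg] at hkey
  have hm0 := Real.exp_pos m
  have h2 : (∑ i, Real.exp (φ i)) * (n * (Real.exp m)⁻¹) * (Real.exp m / n)
      ≤ n * (n * Real.exp (w ^ 2 / 2)) * (Real.exp m / n) :=
    mul_le_mul_of_nonneg_right hkey (div_pos hm0 hn0).le
  calc _ = (∑ i, Real.exp (φ i)) * (n * (Real.exp m)⁻¹) * (Real.exp m / n) := by field_simp
    _ ≤ _ := h2
    _ = _ := by field_simp

section Chain

variable {G : Type*} [Group G]

/-- The average of `f` over the left coset `g * H`. -/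
noncomputable def cosetAvg (f : G → ℝ) (H : Subgroup G) [Fintype H] (g : G) : ℝ :=
  (∑ h : H, f (g * h)) / Fintype.card H

theorem sum_mul_right_eq (f : G → ℝ) (H : Subgroup G) [Fintype H] (g : G) (k : G) (hk : k ∈ H) :
    ∑ h : H, f (g * h * k) = ∑ h : H, f (g * h) :=
  Fintype.sum_equiv (Equiv.mulRight (⟨k, hk⟩ : H)) _ _ fun h => by simp [mul_assoc]

theorem sum_mul_left_eq (f : G → ℝ) (H : Subgroup G) [Fintype H] (g : G) (k : G) (hk : k ∈ H) :
    ∑ h : H, f (g * k * h) = ∑ h : H, f (g * h) :=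
  Fintype.sum_equiv (Equiv.mulLeft (⟨k, hk⟩ : H)) _ _ fun h => by simp [mul_assoc]

theorem cosetAvg_eq_of_mem (f : G → ℝ) (H : Subgroup G) [Fintype H] {x y : G}
    (h : x⁻¹ * y ∈ H) : cosetAvg f H x = cosetAvg f H y := by
  have := sum_mul_left_eq f H x _ h
  rw [mul_inv_cancel_left] at this
  rw [cosetAvg, cosetAvg, this]

theorem sum_cosetAvg (f : G → ℝ) {H K : Subgroup G} [Fintype H] [Fintype K] (hKH : K ≤ H) (g : G) :
    ∑ h : H, cosetAvg f K (g * h) = ∑ h : H, f (g * h) := by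
  have hK : (Fintype.card K : ℝ) ≠ 0 := by exact_mod_cast Fintype.card_ne_zero
  simp only [cosetAvg]
  rw [← Finset.sum_div, Finset.sum_comm]
  simp only [fun k : K => sum_mul_right_eq f H g k (hKH k.2)]
  rw [Finset.sum_const, Finset.card_univ, nsmul_eq_mul, mul_div_cancel_left₀ _ hK]

theorem abs_cosetAvg_sub_le (f : G → ℝ) (H : Subgroup G) [Fintype H] {u : G} {w : ℝ}
    (hu : ∀ z, |f (u * z) - f z| ≤ w) (x : G) :
    |cosetAvg f H (u * x) - cosetAvg f H x| ≤ w := by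
  have hH : (0 : ℝ) < Fintype.card H := by exact_mod_cast Fintype.card_pos
  rw [cosetAvg, cosetAvg, ← sub_div, abs_div, abs_of_pos hH, div_le_iff₀ hH,
    ← Finset.sum_sub_distrib]
  calc _ ≤ ∑ h : H, |f (u * x * h) - f (x * h)| := Finset.abs_sum_le_sum_abs _ _
    _ ≤ ∑ _h : H, w := Finset.sum_le_sum fun h _ => by rw [mul_assoc]; exact hu _
    _ = w * Fintype.card H := by simp [mul_comm]

/-- Apply the one-step moment bound to the $K$-averages inside a coset of $H$: their mean is the
$H$-average, and they differ pairwise by at most $w$. Each step of a chain thus adds $w^2/2$ to the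
exponent. -/
theorem sum_exp_le_of_subgroup (f : G → ℝ) {H K : Subgroup G} [Fintype H] [Fintype K]
    (hKH : K ≤ H) {s w : ℝ}
    (hK : ∀ g, cosetAvg (fun x => Real.exp (f x)) K g ≤ Real.exp s * Real.exp (cosetAvg f K g))
    (hw : ∀ x y, x⁻¹ * y ∈ H → |cosetAvg f K x - cosetAvg f K y| ≤ w) (g : G) :
    cosetAvg (fun x => Real.exp (f x)) H g ≤
      Real.exp (s + w ^ 2 / 2) * Real.exp (cosetAvg f H g) := by
  have hH : (0 : ℝ) < Fintype.card H := by exact_mod_cast Fintype.card_pos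
  have h1 := sum_exp_le_of_abs_sub_le (fun h : H => cosetAvg f K (g * h)) (w := w)
    fun h k => hw _ _ (by
      have : (g * (h : G))⁻¹ * (g * k) = (h⁻¹ * k : H) := by simp [mul_assoc]
      rw [this]; exact Subtype.property _)
  rw [sum_cosetAvg f hKH g] at h1
  rw [cosetAvg, div_le_iff₀ hH, ← sum_cosetAvg (fun x => Real.exp (f x)) hKH g]
  calc _ ≤ ∑ h : H, Real.exp s * Real.exp (cosetAvg f K (g * h)) :=
        Finset.sum_le_sum fun h _ => hK _
    _ ≤ Real.exp s * (Fintype.card H * Real.exp (w ^ 2 / 2) * Real.exp (cosetAvg f H g)) := by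
        rw [← Finset.mul_sum]; gcongr; exact h1
    _ = _ := by rw [Real.exp_add]; ring

/-- Exponential moments along a chain of subgroups. -/
theorem sum_exp_le_of_chain (f : G → ℝ) (H : ℕ → Subgroup G) [∀ i, Fintype (H i)]
    (hle : ∀ i, H (i + 1) ≤ H i) {n : ℕ} (hn : H n = ⊥) {w : ℝ}
    (hstep : ∀ i < n, ∀ x y, x⁻¹ * y ∈ H i →
      ∃ u, (u * x)⁻¹ * y ∈ H (i + 1) ∧ ∀ z, |f (u * z) - f z| ≤ w) {m : ℕ} (hm : m ≤ n) (g : G) :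
    cosetAvg (fun x => Real.exp (f x)) (H (n - m)) g ≤
      Real.exp (m * (w ^ 2 / 2)) * Real.exp (cosetAvg f (H (n - m)) g) := by
  -- The induction climbs from $H_n=\bot$, where averaging does nothing, towards $H_0$.
  induction m generalizing g with
  | zero =>
    have : ∀ h : H (n - 0), (h : G) = 1 := fun h => Subgroup.mem_bot.1 (hn ▸ h.2)
    simp [cosetAvg, this]
  | succ m ih =>
    have e : n - (m + 1) + 1 = n - m := by omega
    have h1 : H (n - m) ≤ H (n - (m + 1)) := e ▸ hle (n - (m + 1))
    have := sum_exp_le_of_subgroup f h1 (ih (by omega)) (w := w) ?_ g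
    · convert this using 3
      push_cast
      ring
    · intro x y hxy
      -- Left translation by $u$ carries the coset of $x$ onto that of $y$ and changes $f$ by at
      -- most $w$ pointwise, hence changes the average by at most $w$.
      obtain ⟨u, hu, hu'⟩ := hstep _ (by omega) x y hxy
      rw [e] at hu
      rw [← cosetAvg_eq_of_mem f _ hu, abs_sub_comm]
      exact abs_cosetAvg_sub_le f _ hu' x

theorem cosetAvg_top [Fintype G] (f : G → ℝ) (H : Subgroup G) [Fintype H] (hH : H = ⊤) :
    cosetAvg f H 1 = (∑ g, f g) / Fintype.card G := by
  subst hH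
  have e : Fintype.card (⊤ : Subgroup G) = Fintype.card G :=
    Fintype.card_congr Subgroup.topEquiv.toEquiv
  rw [cosetAvg, e]
  congr 1
  exact Fintype.sum_equiv Subgroup.topEquiv.toEquiv _ _ fun h => by simp

/-- Concentration of measure along a chain of subgroups: an upper tail bound. -/
theorem card_tail_le_of_chain [Fintype G] (f : G → ℝ) (H : ℕ → Subgroup G)
    (hle : ∀ i, H (i + 1) ≤ H i) (h0 : H 0 = ⊤) {n : ℕ} (hpos : 0 < n) (hn : H n = ⊥) {w : ℝ}
    (hw : 0 < w)
    (hstep : ∀ i < n, ∀ x y, x⁻¹ * y ∈ H i →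
      ∃ u, (u * x)⁻¹ * y ∈ H (i + 1) ∧ ∀ z, |f (u * z) - f z| ≤ w) {δ : ℝ} (hδ : 0 ≤ δ) :
    (Nat.card {g : G // (∑ g, f g) / Fintype.card G + δ < f g} : ℝ) ≤
      Fintype.card G * Real.exp (-(δ ^ 2 / (2 * n * w ^ 2))) := by
  classical
  set m := (∑ g, f g) / Fintype.card G with hm
  have hn' : (0 : ℝ) < n := by exact_mod_cast hpos
  have hG : (0 : ℝ) < Fintype.card G := by exact_mod_cast Fintype.card_pos
  -- The minimizer of the Chernoff exponent $n t^2w^2/2 - t\delta$.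
  set t : ℝ := δ / (n * w ^ 2) with ht
  have ht0 : 0 ≤ t := by positivity
  have := sum_exp_le_of_chain (fun x => t * f x) H hle hn (w := t * w) (fun i hi x y hxy => by
    obtain ⟨u, hu, hu'⟩ := hstep i hi x y hxy
    refine ⟨u, hu, fun z => ?_⟩
    rw [← mul_sub, abs_mul, abs_of_nonneg ht0]
    exact mul_le_mul_of_nonneg_left (hu' z) ht0) le_rfl 1
  rw [cosetAvg_top _ _ (by rw [Nat.sub_self, h0]), cosetAvg_top _ _ (by rw [Nat.sub_self, h0]),
    ← Finset.mul_sum, mul_div_assoc, ← hm, div_le_iff₀ hG] at this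
  have hmarkov : (Nat.card {g : G // m + δ < f g} : ℝ) * Real.exp (t * (m + δ)) ≤
      ∑ g, Real.exp (t * f g) := by
    rw [Nat.card_eq_fintype_card, Fintype.card_subtype, ← nsmul_eq_mul, ← Finset.sum_const]
    refine (Finset.sum_le_sum fun g hg => ?_).trans
      (Finset.sum_le_univ_sum_of_nonneg fun g => (Real.exp_pos _).le)
    have : m + δ < f g := (Finset.mem_filter.1 hg).2
    exact Real.exp_le_exp.2 (by gcongr)
  have h2 := hmarkov.trans this
  rw [← le_div_iff₀ (Real.exp_pos _)] at h2
  refine h2.trans (le_of_eq ?_)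
  rw [← Real.exp_add, mul_comm, mul_div_assoc, ← Real.exp_sub]
  congr 2
  rw [ht]
  field_simp
  ring

/-- Concentration of measure along a chain of subgroups. -/
theorem card_abs_tail_le_of_chain [Fintype G] (f : G → ℝ) (H : ℕ → Subgroup G)
    (hle : ∀ i, H (i + 1) ≤ H i) (h0 : H 0 = ⊤) {n : ℕ} (hpos : 0 < n) (hn : H n = ⊥) {w : ℝ}
    (hw : 0 < w)
    (hstep : ∀ i < n, ∀ x y, x⁻¹ * y ∈ H i →
      ∃ u, (u * x)⁻¹ * y ∈ H (i + 1) ∧ ∀ z, |f (u * z) - f z| ≤ w) {δ : ℝ} (hδ : 0 ≤ δ) :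
    (Nat.card {g : G // δ < |f g - (∑ g, f g) / Fintype.card G|} : ℝ) ≤
      2 * (Fintype.card G * Real.exp (-(δ ^ 2 / (2 * n * w ^ 2)))) := by
  classical
  have h1 := card_tail_le_of_chain f H hle h0 hpos hn hw hstep hδ
  have h2 := card_tail_le_of_chain (fun x => -f x) H hle h0 hpos hn hw (fun i hi x y hxy => by
    obtain ⟨u, hu, hu'⟩ := hstep i hi x y hxy
    refine ⟨u, hu, fun z => ?_⟩
    rw [← abs_neg]
    convert hu' z using 2
    ring) hδ
  rw [Finset.sum_neg_distrib, neg_div] at h2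
  set m := (∑ g, f g) / Fintype.card G with hm
  simp only [Nat.card_eq_fintype_card, Fintype.card_subtype] at h1 h2 ⊢
  have h3 : (Finset.univ.filter fun g => δ < |f g - m|) ⊆
      (Finset.univ.filter fun g => m + δ < f g) ∪ Finset.univ.filter fun g => -m + δ < -f g := by
    intro g hg
    simp only [Finset.mem_filter, Finset.mem_univ, true_and, Finset.mem_union] at hg ⊢
    rcases lt_abs.1 hg with h | h
    · left; linarith
    · right; linarith
  have h4 : ((Finset.univ.filter fun g => δ < |f g - m|).card : ℝ) ≤
      (Finset.univ.filter fun g => m + δ < f g).card +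
        (Finset.univ.filter fun g => -m + δ < -f g).card := by
    exact_mod_cast (Finset.card_le_card h3).trans (Finset.card_union_le _ _)
  linarith

end Chain

end MatrixRamsey

/-! ### Concentration of measure in the general linear group -/

namespace MatrixRamsey

open Matrix

section GeneralLinear

variable {F : Type*} [Field F] {n : ℕ}

/-- The pointwise stabilizer of the first `i` standard basis vectors. -/
def basisStabilizer (F : Type*) [Field F] (n i : ℕ) : Subgroup (Matrix (Fin n) (Fin n) F)ˣ where
  carrier := {g | ∀ j : Fin n, (j : ℕ) < i →
    (g : Matrix (Fin n) (Fin n) F) *ᵥ Pi.single j 1 = Pi.single j 1}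
  one_mem' _ _ := one_mulVec _
  mul_mem' {g h} hg hh j hj := by
    rw [Units.val_mul, ← mulVec_mulVec, hh j hj, hg j hj]
  inv_mem' {g} hg j hj := by
    conv_lhs => rw [← hg j hj]
    rw [mulVec_mulVec, Units.inv_mul, one_mulVec]

theorem mem_basisStabilizer {i : ℕ} {g : (Matrix (Fin n) (Fin n) F)ˣ} :
    g ∈ basisStabilizer F n i ↔ ∀ j : Fin n, (j : ℕ) < i →
      (g : Matrix (Fin n) (Fin n) F) *ᵥ Pi.single j 1 = Pi.single j 1 := Iff.rfl

/-- Cosets of the stabilizer record the first $i$ columns of a matrix. -/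
theorem inv_mul_mem_basisStabilizer {i : ℕ} {x y : (Matrix (Fin n) (Fin n) F)ˣ} :
    x⁻¹ * y ∈ basisStabilizer F n i ↔ ∀ j : Fin n, (j : ℕ) < i →
      (y : Matrix (Fin n) (Fin n) F) *ᵥ Pi.single j 1 =
        (x : Matrix (Fin n) (Fin n) F) *ᵥ Pi.single j 1 := by
  rw [mem_basisStabilizer]
  refine forall₂_congr fun j _ => ⟨fun h => ?_, fun h => ?_⟩
  · conv_rhs => rw [← h]
    rw [mulVec_mulVec, ← Units.val_mul, mul_inv_cancel_left]
  · rw [Units.val_mul, ← mulVec_mulVec, h, mulVec_mulVec, Units.inv_mul, one_mulVec]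

theorem basisStabilizer_succ_le (i : ℕ) : basisStabilizer F n (i + 1) ≤ basisStabilizer F n i :=
  fun _ hg j hj => hg j (by omega)

theorem basisStabilizer_zero : basisStabilizer F n 0 = ⊤ :=
  eq_top_iff.2 fun _ _ _ hj => absurd hj (Nat.not_lt_zero _)

theorem basisStabilizer_self : basisStabilizer F n n = ⊥ := by
  refine eq_bot_iff.2 fun g hg => Subgroup.mem_bot.2 (Units.ext ?_)
  refine Matrix.ext_of_mulVec_single fun j => ?_
  rw [hg j j.2, Units.val_one, one_mulVec]

/-- A rank one perturbation of the identity that fixes the kernel of `φ` and maps `v` to `v'`. -/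
theorem exists_unit_rank_sub_one_le (φ v v' : Fin n → F) (hv : φ ⬝ᵥ v ≠ 0) (hv' : φ ⬝ᵥ v' ≠ 0) :
    ∃ u : (Matrix (Fin n) (Fin n) F)ˣ, ((u : Matrix (Fin n) (Fin n) F) - 1).rank ≤ 1 ∧
      (u : Matrix (Fin n) (Fin n) F) *ᵥ v = v' ∧
      ∀ z, φ ⬝ᵥ z = 0 → (u : Matrix (Fin n) (Fin n) F) *ᵥ z = z := by
  -- The witness is $u = 1 + \varphi(v)^{-1}(v'-v)\varphi$; its inverse has the same shape, with
  -- $\varphi(v')$ as denominator and the opposite sign.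
  have hinv : (1 + (φ ⬝ᵥ v)⁻¹ • vecMulVec (v' - v) φ) *
      (1 - (φ ⬝ᵥ v')⁻¹ • vecMulVec (v' - v) φ) = 1 := by
    have h : vecMulVec (v' - v) φ * vecMulVec (v' - v) φ =
        (φ ⬝ᵥ v' - φ ⬝ᵥ v) • vecMulVec (v' - v) φ := by
      rw [vecMulVec_mul_vecMulVec, dotProduct_sub, vecMulVec_smul]
    rw [mul_sub, mul_one, add_mul, one_mul, smul_mul_smul_comm, h, smul_smul, add_sub_assoc,
      ← add_smul, ← sub_smul]
    rw [add_eq_left]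
    refine smul_eq_zero_of_left ?_ _
    field_simp
    ring
  refine ⟨⟨_, _, hinv, mul_eq_one_comm.1 hinv⟩, ?_, ?_, fun z hz => ?_⟩
  · rw [add_sub_cancel_left, ← vecMulVec_smul]
    exact rank_vecMulVec_le _ _
  · simp only [add_mulVec, one_mulVec, smul_mulVec, vecMulVec_mulVec]
    ext i
    simp
    field_simp
    ring
  · simp only [add_mulVec, one_mulVec, smul_mulVec, vecMulVec_mulVec, hz]
    simp

/-- The columns of $x$ and $y$ agree before index $i$. A rank one perturbation of the identity can
fix these columns and send column $i$ of $x$ to that of $y$, provided some functional kills the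
former and is nonzero on both of the latter. -/
theorem exists_unit_of_basisStabilizer {i : ℕ} (hi : i < n) (x y : (Matrix (Fin n) (Fin n) F)ˣ)
    (hxy : x⁻¹ * y ∈ basisStabilizer F n i) :
    ∃ u : (Matrix (Fin n) (Fin n) F)ˣ, (u * x)⁻¹ * y ∈ basisStabilizer F n (i + 1) ∧
      ((u : Matrix (Fin n) (Fin n) F) - 1).rank ≤ 1 := by
  rw [inv_mul_mem_basisStabilizer] at hxy
  let k : Fin n := ⟨i, hi⟩
  have hrow : ∀ (g : (Matrix (Fin n) (Fin n) F)ˣ) (j : Fin n),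
      (g⁻¹ : (Matrix (Fin n) (Fin n) F)ˣ).val k ⬝ᵥ (g.val *ᵥ Pi.single j 1) =
        if j = k then 1 else 0 := fun g j => by
    have h : (g⁻¹ : (Matrix (Fin n) (Fin n) F)ˣ).val *ᵥ (g.val *ᵥ Pi.single j 1) =
        Pi.single j 1 := by
      rw [mulVec_mulVec, Units.inv_mul, one_mulVec]
    have := congrFun h k
    rw [mulVec] at this
    rw [this, Pi.single_apply]
    simp [eq_comm]
  set p := (x⁻¹ : (Matrix (Fin n) (Fin n) F)ˣ).val k
  set q := (y⁻¹ : (Matrix (Fin n) (Fin n) F)ˣ).val k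
  set v := x.val *ᵥ Pi.single k 1
  set v' := y.val *ᵥ Pi.single k 1
  have hpv : p ⬝ᵥ v = 1 := (hrow x k).trans (if_pos rfl)
  have hqv' : q ⬝ᵥ v' = 1 := (hrow y k).trans (if_pos rfl)
  have hne : ∀ j : Fin n, (j : ℕ) < i → j ≠ k := fun j hj h => by simp [h, k] at hj
  have hp : ∀ j : Fin n, (j : ℕ) < i → p ⬝ᵥ (x.val *ᵥ Pi.single j 1) = 0 := fun j hj =>
    (hrow x j).trans (if_neg (hne j hj))
  have hq : ∀ j : Fin n, (j : ℕ) < i → q ⬝ᵥ (x.val *ᵥ Pi.single j 1) = 0 := fun j hj => by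
    rw [← hxy j hj]
    exact (hrow y j).trans (if_neg (hne j hj))
  -- Row $i$ of $x^{-1}$ or of $y^{-1}$ serves unless each vanishes on the other matrix's column
  -- $i$; then their sum takes the value 1 on both columns.
  obtain ⟨φ, hφ, hφv, hφv'⟩ : ∃ φ : Fin n → F,
      (∀ j : Fin n, (j : ℕ) < i → φ ⬝ᵥ (x.val *ᵥ Pi.single j 1) = 0) ∧
        φ ⬝ᵥ v ≠ 0 ∧ φ ⬝ᵥ v' ≠ 0 := by
    by_cases h1 : p ⬝ᵥ v' = 0
    · by_cases h2 : q ⬝ᵥ v = 0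
      · refine ⟨p + q, fun j hj => ?_, ?_, ?_⟩
        · rw [add_dotProduct, hp j hj, hq j hj, add_zero]
        · simp [add_dotProduct, hpv, h2]
        · simp [add_dotProduct, hqv', h1]
      · exact ⟨q, hq, h2, by simp [hqv']⟩
    · exact ⟨p, hp, by simp [hpv], h1⟩
  obtain ⟨u, hu1, huv, hu⟩ := exists_unit_rank_sub_one_le φ v v' hφv hφv'
  refine ⟨u, inv_mul_mem_basisStabilizer.2 fun j hj => ?_, hu1⟩
  rw [Units.val_mul, ← mulVec_mulVec]
  rcases Nat.lt_succ_iff_lt_or_eq.1 hj with hj | hj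
  · rw [hu _ (hφ j hj), hxy j hj]
  · have : j = k := Fin.ext hj
    rw [this]
    exact huv.symm

/-- Concentration of measure in `GL_n(F)` with respect to the rank metric. -/
theorem card_abs_tail_le_of_rank [Fintype (Matrix (Fin n) (Fin n) F)ˣ] (hn : 0 < n)
    (f : (Matrix (Fin n) (Fin n) F)ˣ → ℝ) {w : ℝ} (hw : 0 < w)
    (hf : ∀ u : (Matrix (Fin n) (Fin n) F)ˣ, ((u : Matrix (Fin n) (Fin n) F) - 1).rank ≤ 1 →
      ∀ z, |f (u * z) - f z| ≤ w) {δ : ℝ} (hδ : 0 ≤ δ) :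
    (Nat.card {g // δ < |f g - (∑ g, f g) / Fintype.card (Matrix (Fin n) (Fin n) F)ˣ|} : ℝ) ≤
      2 * (Fintype.card (Matrix (Fin n) (Fin n) F)ˣ *
        Real.exp (-(δ ^ 2 / (2 * n * w ^ 2)))) :=
  card_abs_tail_le_of_chain f (basisStabilizer F n) basisStabilizer_succ_le basisStabilizer_zero hn
    basisStabilizer_self hw
    (fun _ hi x y hxy => by
      obtain ⟨u, hu, hu1⟩ := exists_unit_of_basisStabilizer hi x y hxy
      exact ⟨u, hu, hf u hu1⟩) hδ

end GeneralLinear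

end MatrixRamsey

/-! ### Representations of matrix algebras and the Skolem–Noether theorem -/

namespace MatrixRamsey

open Matrix

section SkolemNoether

variable {F : Type*} [Field F] {ι : Type*} [Fintype ι] [DecidableEq ι]
  {V : Type*} [AddCommGroup V] [Module F V]

theorem single_mul_eq_sum (i₀ i : ι) (M : Matrix ι ι F) :
    single i₀ i 1 * M = ∑ l, M i l • single i₀ l (1 : F) := by
  ext p q
  simp only [Matrix.sum_apply, Matrix.smul_apply, single_apply, Matrix.mul_apply, smul_eq_mul]
  by_cases hp : i₀ = p <;> simp [hp]

/-- A module over a matrix algebra is a power of the range of a diagonal matrix unit. -/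
noncomputable def matrixModuleEquiv (φ : Matrix ι ι F →ₐ[F] Module.End F V) (i₀ : ι) :
    V ≃ₗ[F] (ι → LinearMap.range (φ (single i₀ i₀ 1))) where
  toFun v i := ⟨φ (single i₀ i 1) v, φ (single i₀ i 1) v, by
    rw [← Module.End.mul_apply, ← map_mul, single_mul_single_same, one_mul]⟩
  map_add' v w := by ext i; simp
  map_smul' r v := by ext i; simp
  invFun w := ∑ i, φ (single i i₀ 1) (w i)
  left_inv v := by
    have h : ∑ i : ι, single i i (1 : F) = 1 := by
      ext p q
      simp [Matrix.sum_apply, single_apply, Matrix.one_apply, ite_and]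
    simp only [← Module.End.mul_apply, ← map_mul, single_mul_single_same, one_mul]
    rw [← LinearMap.sum_apply, ← map_sum, h, map_one, Module.End.one_apply]
  right_inv w := by
    ext i
    simp only [map_sum]
    rw [Finset.sum_eq_single i]
    · rw [← Module.End.mul_apply, ← map_mul, single_mul_single_same, one_mul]
      obtain ⟨v, hv⟩ := (w i).2
      rw [← hv, ← Module.End.mul_apply, ← map_mul, single_mul_single_same, one_mul]
    · intro j _ hj
      rw [← Module.End.mul_apply, ← map_mul, single_mul_single_of_ne _ _ _ _ (Ne.symm hj), map_zero,
        LinearMap.zero_apply]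
    · simp

/-- In these coordinates $M$ acts by the usual matrix formula, with no trace of $\varphi$; so a
representation is determined by the dimension of one coordinate space. -/
theorem matrixModuleEquiv_apply (φ : Matrix ι ι F →ₐ[F] Module.End F V) (i₀ : ι)
    (M : Matrix ι ι F) (v : V) (i : ι) :
    matrixModuleEquiv φ i₀ (φ M v) i = ∑ l, M i l • matrixModuleEquiv φ i₀ v l := by
  ext
  have : φ (single i₀ i 1) (φ M v) = ∑ l, M i l • φ (single i₀ l 1) v := by
    rw [← Module.End.mul_apply, ← map_mul, single_mul_eq_sum, map_sum, LinearMap.sum_apply]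
    simp only [map_smul, LinearMap.smul_apply]
  simpa [matrixModuleEquiv] using this

variable [FiniteDimensional F V]

theorem finrank_eq_card_mul (φ : Matrix ι ι F →ₐ[F] Module.End F V) (i₀ : ι) :
    Module.finrank F V =
      Fintype.card ι * Module.finrank F (LinearMap.range (φ (single i₀ i₀ 1))) := by
  rw [(matrixModuleEquiv φ i₀).finrank_eq, Module.finrank_pi_fintype]
  simp

/-- Any two representations of a matrix algebra on the same space are equivalent. -/
theorem exists_linearEquiv_intertwining [Nonempty ι] (φ ψ : Matrix ι ι F →ₐ[F] Module.End F V) :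
    ∃ g : V ≃ₗ[F] V, ∀ M v, g (φ M v) = ψ M (g v) := by
  obtain ⟨i₀⟩ := ‹Nonempty ι›
  have hr : Module.finrank F (LinearMap.range (φ (single i₀ i₀ 1))) =
      Module.finrank F (LinearMap.range (ψ (single i₀ i₀ 1))) :=
    Nat.eq_of_mul_eq_mul_left (Fintype.card_pos_iff.2 ⟨i₀⟩)
      ((finrank_eq_card_mul φ i₀).symm.trans (finrank_eq_card_mul ψ i₀))
  let u := LinearEquiv.ofFinrankEq _ _ hr
  refine ⟨matrixModuleEquiv φ i₀ ≪≫ₗ LinearEquiv.piCongrRight (fun _ => u) ≪≫ₗ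
    (matrixModuleEquiv ψ i₀).symm, fun M v => (matrixModuleEquiv ψ i₀).injective ?_⟩
  funext i
  simp [matrixModuleEquiv_apply]

end SkolemNoether

variable {F : Type*} [Field F] {a n : ℕ}

/-- The Skolem-Noether theorem for embeddings of `M_a(F)` in `M_n(F)`. -/
theorem exists_unit_mul_eq (ha : 0 < a)
    (φ ψ : Matrix (Fin a) (Fin a) F →ₐ[F] Matrix (Fin n) (Fin n) F) :
    ∃ g : (Matrix (Fin n) (Fin n) F)ˣ, ∀ M, (g : Matrix (Fin n) (Fin n) F) * φ M = ψ M * g := by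
  have : Nonempty (Fin a) := ⟨⟨0, ha⟩⟩
  let T : Matrix (Fin n) (Fin n) F ≃ₐ[F] Module.End F (Fin n → F) := toLinAlgEquiv'
  obtain ⟨g, hg⟩ := exists_linearEquiv_intertwining
    (T.toAlgHom.comp φ) (T.toAlgHom.comp ψ)
  refine ⟨⟨T.symm g.toLinearMap, T.symm g.symm.toLinearMap, ?_, ?_⟩, fun M => T.injective ?_⟩
  · rw [← map_mul, ← map_one T.symm]
    exact congrArg T.symm (LinearMap.ext fun v => g.apply_symm_apply v)
  · rw [← map_mul, ← map_one T.symm]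
    exact congrArg T.symm (LinearMap.ext fun v => g.symm_apply_apply v)
  · change T (T.symm g.toLinearMap * φ M) = T (ψ M * T.symm g.toLinearMap)
    rw [map_mul, map_mul, T.apply_symm_apply]
    exact LinearMap.ext fun v => hg M v

/-- The space $F^n$ becomes an $M_a(F)$-module, hence an $a$-fold power of a vector space. -/
theorem dvd_of_algHom (ha : 0 < a)
    (φ : Matrix (Fin a) (Fin a) F →ₐ[F] Matrix (Fin n) (Fin n) F) : a ∣ n := by
  have h := finrank_eq_card_mul
    ((toLinAlgEquiv' : Matrix (Fin n) (Fin n) F ≃ₐ[F] Module.End F (Fin n → F)).toAlgHom.comp φ)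
    ⟨0, ha⟩
  rw [Module.finrank_fin_fun, Fintype.card_fin] at h
  exact ⟨_, h⟩

/-- The block diagonal embedding of `M_a(F)` in `M_n(F)` for `a ∣ n`. -/
theorem nonempty_algHom_of_dvd (h : a ∣ n) :
    Nonempty (Matrix (Fin a) (Fin a) F →ₐ[F] Matrix (Fin n) (Fin n) F) := by
  obtain ⟨k, rfl⟩ := h
  let e : Matrix (Fin a × Fin k) (Fin a × Fin k) F ≃ₐ[F] Matrix (Fin (a * k)) (Fin (a * k)) F :=
    reindexAlgEquiv F F finProdFinEquiv
  let d : Matrix (Fin a) (Fin a) F →ₐ[F] Matrix (Fin a × Fin k) (Fin a × Fin k) F :=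
    { (blockDiagonalRingHom (Fin a) (Fin k) F).comp
        (Pi.constRingHom (Fin k) (Matrix (Fin a) (Fin a) F)) with
      commutes' := fun r => by
        ext ⟨i, k⟩ ⟨j, l⟩
        simp [blockDiagonal_apply, algebraMap_matrix_apply, Prod.ext_iff, ite_and]
        by_cases hij : i = j <;> by_cases hkl : k = l <;> simp [hij, hkl] }
  exact ⟨e.toAlgHom.comp d⟩

end MatrixRamsey

/-! ### Copies of a matrix algebra under embeddings and conjugation -/

namespace MatrixRamsey

open Matrix

section CopiesMap

variable {F : Type*} [Field F] {a b n m : ℕ}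

/-- The image of a copy of `M_a(F)` under an embedding `M_n(F) → M_m(F)`. -/
noncomputable def Copies.map (f : Matrix (Fin n) (Fin n) F →ₐ[F] Matrix (Fin m) (Fin m) F)
    (hf : Function.Injective f) (S : Copies F a n) : Copies F a m :=
  ⟨S.alg.map f, ⟨S.isCopy.some.trans (S.alg.equivMapOfInjective f hf)⟩⟩

/-- The range of an embedding `M_b(F) → M_m(F)`, as a copy of `M_b(F)`. -/
noncomputable def Copies.range (f : Matrix (Fin b) (Fin b) F →ₐ[F] Matrix (Fin m) (Fin m) F)
    (hf : Function.Injective f) : Copies F b m :=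
  ⟨f.range, ⟨AlgEquiv.ofInjective f hf⟩⟩

/-- Pulling back along $f$ shows that the copies of $A$ inside an embedded $B$ are indexed by the
copies in $B$ itself, so the union bound has only $k$ terms. -/
theorem exists_map_eq_of_mem_copiesIn
    (f : Matrix (Fin b) (Fin b) F →ₐ[F] Matrix (Fin m) (Fin m) F) (hf : Function.Injective f)
    {A : Copies F a m} (hA : A ∈ copiesIn a (Copies.range f hf)) :
    ∃ S : Copies F a b, S.map f hf = A := by
  have h : (A.alg.comap f).map f = A.alg := by
    refine le_antisymm ?_ fun y hy => ?_
    · rintro _ ⟨x, hx, rfl⟩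
      exact hx
    · obtain ⟨x, rfl⟩ := hA hy
      exact ⟨x, hy, rfl⟩
  exact ⟨⟨A.alg.comap f, ⟨A.isCopy.some.trans ((Subalgebra.equivOfEq _ _ h.symm).trans
    ((A.alg.comap f).equivMapOfInjective f hf).symm)⟩⟩, Copies.alg_injective h⟩

/-- The inclusion of a copy of `M_a(F)`, as an algebra homomorphism on `M_a(F)`. -/
noncomputable def Copies.hom (S : Copies F a n) :
    Matrix (Fin a) (Fin a) F →ₐ[F] Matrix (Fin n) (Fin n) F :=
  S.alg.val.comp S.isCopy.some.toAlgHom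

theorem Copies.range_hom (S : Copies F a n) : S.hom.range = S.alg := by
  refine SetLike.ext fun x => ⟨?_, fun hx => ?_⟩
  · rintro ⟨y, rfl⟩
    exact (S.isCopy.some y).2
  · exact ⟨S.isCopy.some.symm ⟨x, hx⟩, by simp [Copies.hom]⟩

theorem Copies.dvd (ha : 0 < a) (S : Copies F a n) : a ∣ n := dvd_of_algHom ha S.hom

theorem algHom_injective (hb : 0 < b)
    (f : Matrix (Fin b) (Fin b) F →ₐ[F] Matrix (Fin m) (Fin m) F) (hm : 0 < m) :
    Function.Injective f := by
  have : Nonempty (Fin b) := ⟨⟨0, hb⟩⟩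
  have : Nonempty (Fin m) := ⟨⟨0, hm⟩⟩
  exact f.toRingHom.injective

theorem Copies.nonempty_of_dvd (ha : 0 < a) (hn : 0 < n) (h : a ∣ n) : Nonempty (Copies F a n) :=
  let ⟨f⟩ := nonempty_algHom_of_dvd (F := F) h
  ⟨Copies.range f (algHom_injective ha f hn)⟩

/-- Conjugation by an invertible matrix. -/
noncomputable def conjEquiv (g : (Matrix (Fin n) (Fin n) F)ˣ) :
    Matrix (Fin n) (Fin n) F ≃ₐ[F] Matrix (Fin n) (Fin n) F :=
  MulSemiringAction.toAlgEquiv F _ (ConjAct.toConjAct g)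

theorem conjEquiv_apply (g : (Matrix (Fin n) (Fin n) F)ˣ) (x : Matrix (Fin n) (Fin n) F) :
    conjEquiv g x = g * x * (g⁻¹ : (Matrix (Fin n) (Fin n) F)ˣ) := by
  simp [conjEquiv, ConjAct.units_smul_def]

/-- The conjugate `g S g⁻¹` of a copy. -/
noncomputable def Copies.conj (g : (Matrix (Fin n) (Fin n) F)ˣ) (S : Copies F a n) :
    Copies F a n :=
  S.map (conjEquiv g).toAlgHom (conjEquiv g).injective

theorem Copies.conj_mul (g h : (Matrix (Fin n) (Fin n) F)ˣ) (S : Copies F a n) :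
    S.conj (g * h) = (S.conj h).conj g := by
  refine Copies.alg_injective ?_
  have : (conjEquiv (g * h)).toAlgHom =
      ((conjEquiv g).toAlgHom.comp (conjEquiv h).toAlgHom) := by
    ext1 x
    simp [conjEquiv_apply, mul_assoc]
  simp only [Copies.conj, Copies.map, this, Subalgebra.map_map]

theorem Copies.exists_conj_eq (ha : 0 < a) (S T : Copies F a n) :
    ∃ g : (Matrix (Fin n) (Fin n) F)ˣ, S.conj g = T := by
  obtain ⟨g, hg⟩ := exists_unit_mul_eq ha S.hom T.hom
  refine ⟨g, Copies.alg_injective ?_⟩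
  have h : (conjEquiv g).toAlgHom.comp S.hom = T.hom := by
    ext1 x
    simp [conjEquiv_apply, hg, mul_assoc]
  change S.alg.map _ = T.alg
  rw [← S.range_hom, ← T.range_hom, ← h, AlgHom.range_comp]

variable [Finite F]

theorem Copies.dist_conj_le {u : (Matrix (Fin n) (Fin n) F)ˣ}
    (hu : ((u : Matrix (Fin n) (Fin n) F) - 1).rank ≤ 1) (S : Copies F a n) :
    dist (S.conj u) S ≤ 2 / n := by
  rw [dist_comm]
  refine copyDist_le (S.alg.equivMapOfInjective (conjEquiv u).toAlgHom (conjEquiv u).injective)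
    fun ⟨y, _⟩ => ?_
  change rankDist y (conjEquiv u y) ≤ _
  rw [conjEquiv_apply, rankDist_comm, rankDist]
  gcongr
  set v := (u⁻¹ : (Matrix (Fin n) (Fin n) F)ˣ).val
  -- Here $uyu^{-1}-y = (u-1)yu^{-1} - yu^{-1}(u-1)$; each term has rank at most 1.
  have e : (u : Matrix (Fin n) (Fin n) F) * y * v - y =
      (u.val - 1) * (y * v) + y * -v * (u.val - 1) := by
    have : v * u.val = 1 := Units.inv_mul u
    rw [mul_sub, mul_assoc y, neg_mul, this]
    noncomm_ring
  rw [e]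
  have h := (rank_add_le ((u.val - 1) * (y * v)) (y * -v * (u.val - 1))).trans
    (add_le_add ((rank_mul_le_left _ _).trans hu) ((rank_mul_le_right _ _).trans hu))
  exact_mod_cast h

/-- If a copy exists, the copies form a single orbit of $GL_n(F)$, which sits inside $M_n(F)$. -/
theorem card_copies_le (ha : 0 < a) : Nat.card (Copies F a n) ≤ Nat.card F ^ n ^ 2 := by
  rcases isEmpty_or_nonempty (Copies F a n) with _ | ⟨⟨S⟩⟩
  · simp
  calc Nat.card (Copies F a n) ≤ Nat.card (Matrix (Fin n) (Fin n) F)ˣ :=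
        Nat.card_le_card_of_surjective (fun g => S.conj g) (S.exists_conj_eq ha)
    _ ≤ Nat.card (Matrix (Fin n) (Fin n) F) :=
        Nat.card_le_card_of_injective _ Units.val_injective
    _ = Nat.card F ^ n ^ 2 := by
        simp [Matrix, Nat.card_fun, ← pow_mul, sq]

end CopiesMap

/-! ### The Ramsey property from concentration and a union bound -/

section Ramsey

variable {F : Type*} [Field F] {a b c : ℕ}

/-- If $T=kSk^{-1}$, right translation $h \mapsto hk$ identifies the two sums. This common mean is
what links the values on different copies. -/
theorem sum_conj_eq [Fintype (Matrix (Fin c) (Fin c) F)ˣ] (ha : 0 < a) (γ : Copies F a c → ℝ)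
    (S T : Copies F a c) : ∑ h, γ (S.conj h) = ∑ h, γ (T.conj h) := by
  obtain ⟨k, rfl⟩ := Copies.exists_conj_eq ha S T
  exact (Fintype.sum_equiv (Equiv.mulRight k) _ _ fun h => by
    rw [Equiv.coe_mulRight, Copies.conj_mul]).symm

theorem ramseyBound_nonneg (ε : ℝ) : 0 ≤ ramseyBound F a b ε := by
  refine mul_nonneg (by positivity) (le_max_of_le_right ?_)
  have : (6 : ℝ) * (⌈ε⁻¹⌉₊ : ℝ) = ((6 * ⌈ε⁻¹⌉₊ : ℕ) : ℝ) := by push_cast; rfl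
  rw [this]
  exact Real.log_natCast_nonneg _

variable [Finite F]

/-- Union bound: if every $g$ failed for some $i$, the exceptional sets would cover the group, but
together they hold less than its full measure. -/
theorem exists_forall_abs_sub_le [Fintype (Matrix (Fin c) (Fin c) F)ˣ] (hc : 0 < c) {ε : ℝ}
    (hε : 0 < ε) (γ : Copies F a c → unitInterval) (hγ : LipschitzWith 1 γ) {ι : Type*} [Finite ι]
    (S : ι → Copies F a c) (hι : 2 * (Nat.card ι : ℝ) < Real.exp (ε ^ 2 * c / 32)) :
    ∃ g : (Matrix (Fin c) (Fin c) F)ˣ, ∀ i, |(γ ((S i).conj g) : ℝ) -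
      (∑ h, (γ ((S i).conj h) : ℝ)) / Fintype.card (Matrix (Fin c) (Fin c) F)ˣ| ≤ ε / 2 := by
  have := Fintype.ofFinite ι
  by_contra! H
  have hc' : (0 : ℝ) < c := by exact_mod_cast hc
  set N := Fintype.card (Matrix (Fin c) (Fin c) F)ˣ with hN
  have hN0 : (0 : ℝ) < N := by rw [hN]; exact_mod_cast Fintype.card_pos
  have htail : ∀ i, (Nat.card {g : (Matrix (Fin c) (Fin c) F)ˣ // ε / 2 <
      |(γ ((S i).conj g) : ℝ) - (∑ h, (γ ((S i).conj h) : ℝ)) / N|} : ℝ) ≤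
      2 * (N * Real.exp (-(ε ^ 2 * c / 32))) := fun i => by
    -- With $\delta=\varepsilon/2$, $w=2/c$ and $c$ steps, $\delta^2/(2cw^2)=\varepsilon^2c/32$.
    have h := card_abs_tail_le_of_rank hc (fun g => (γ ((S i).conj g) : ℝ)) (w := 2 / c)
      (by positivity) (fun u hu g => by
        rw [← Real.dist_eq, Copies.conj_mul, ← Subtype.dist_eq]
        exact (hγ.dist_le_mul _ _).trans (by
          rw [NNReal.coe_one, one_mul]; exact Copies.dist_conj_le hu _)) (half_pos hε).le
    convert h using 5
    field_simp
    norm_num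
  have hcover : N ≤ ∑ i, Nat.card {g : (Matrix (Fin c) (Fin c) F)ˣ // ε / 2 <
      |(γ ((S i).conj g) : ℝ) - (∑ h, (γ ((S i).conj h) : ℝ)) / N|} := by
    rw [← Nat.card_sigma]
    refine Nat.card_eq_fintype_card.symm.trans_le
      (Nat.card_le_card_of_surjective (fun p => p.2.1) fun g => ?_)
    obtain ⟨i, hi⟩ := H g
    exact ⟨⟨i, g, hi⟩, rfl⟩
  have h1 : (N : ℝ) ≤ Nat.card ι * (2 * (N * Real.exp (-(ε ^ 2 * c / 32)))) := by
    calc (N : ℝ) ≤ ∑ i, (Nat.card {g : (Matrix (Fin c) (Fin c) F)ˣ // ε / 2 <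
          |(γ ((S i).conj g) : ℝ) - (∑ h, (γ ((S i).conj h) : ℝ)) / N|} : ℝ) := by
          exact_mod_cast hcover
      _ ≤ ∑ _i : ι, 2 * (N * Real.exp (-(ε ^ 2 * c / 32))) :=
          Finset.sum_le_sum fun i _ => htail i
      _ = _ := by rw [Finset.sum_const, Finset.card_univ, nsmul_eq_mul, Nat.card_eq_fintype_card]
  have h2 : (Nat.card ι : ℝ) * (2 * (N * Real.exp (-(ε ^ 2 * c / 32)))) < N := by
    calc _ = 2 * (Nat.card ι : ℝ) * (N * Real.exp (-(ε ^ 2 * c / 32))) := by ring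
      _ < Real.exp (ε ^ 2 * c / 32) * (N * Real.exp (-(ε ^ 2 * c / 32))) :=
          mul_lt_mul_of_pos_right hι (mul_pos hN0 (Real.exp_pos _))
      _ = N := by
          rw [mul_left_comm, ← Real.exp_add, add_neg_cancel, Real.exp_zero, mul_one]
  exact absurd h1 (not_le.2 h2)

theorem approxRamsey_of_lt (ha : 0 < a) (hb : 0 < b) (hc : 0 < c) (hbc : b ∣ c) {ε : ℝ}
    (hε : 0 < ε) (h : 2 * (Nat.card (Copies F a b) : ℝ) < Real.exp (ε ^ 2 * c / 32)) :
    ApproxRamsey F a b c ε := by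
  intro γ hγ
  have := Fintype.ofFinite (Matrix (Fin c) (Fin c) F)ˣ
  obtain ⟨f⟩ := nonempty_algHom_of_dvd (F := F) hbc
  have hf := algHom_injective hb f hc
  obtain ⟨g, hg⟩ := exists_forall_abs_sub_le hc hε γ hγ
    (fun S : Copies F a b => S.map f hf) h
  have hf' : Function.Injective ((conjEquiv g).toAlgHom.comp f) := (conjEquiv g).injective.comp hf
  refine ⟨Copies.range _ hf', Metric.diam_le_of_forall_dist_le hε.le ?_⟩
  rintro _ ⟨A, hA, rfl⟩ _ ⟨A', hA', rfl⟩
  obtain ⟨S, rfl⟩ := exists_map_eq_of_mem_copiesIn _ hf' hA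
  obtain ⟨S', rfl⟩ := exists_map_eq_of_mem_copiesIn _ hf' hA'
  have hconj : ∀ S : Copies F a b,
      S.map ((conjEquiv g).toAlgHom.comp f) hf' = (S.map f hf).conj g := fun S =>
    Copies.alg_injective (Subalgebra.map_map _ _ _).symm
  have h1 := hg S
  have h2 := hg S'
  rw [sum_conj_eq ha (fun A => (γ A : ℝ)) (S'.map f hf) (S.map f hf), abs_sub_comm] at h2
  rw [hconj, hconj, Subtype.dist_eq, Real.dist_eq]
  calc _ ≤ _ := abs_sub_le _ _ _
    _ ≤ ε / 2 + ε / 2 := add_le_add h1 h2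
    _ = ε := add_halves ε

theorem approxRamsey_of_ramseyBound_lt (ha : 0 < a) (hb : 0 < b) {ε : ℝ} (hε : 0 < ε)
    (hbc : b ∣ c) (h : ramseyBound F a b ε < c) : ApproxRamsey F a b c ε := by
  have hc' : (0 : ℝ) < c := (ramseyBound_nonneg ε).trans_lt h
  refine approxRamsey_of_lt ha hb (by exact_mod_cast hc') hbc hε ?_
  -- For $k=0$ the logarithm takes its default value, so the exponential inequality is proved
  -- directly.
  rcases Nat.eq_zero_or_pos (Nat.card (Copies F a b)) with h0 | h0
  · rw [h0, Nat.cast_zero, mul_zero]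
    exact Real.exp_pos _
  have hk : (0 : ℝ) < 2 * (Nat.card (Copies F a b) : ℝ) := by positivity
  rw [← Real.log_lt_iff_lt_exp hk]
  have h1 : 64 * (ε ^ 2)⁻¹ * Real.log (2 * (Nat.card (Copies F a b) : ℝ)) < c :=
    (mul_le_mul_of_nonneg_left (le_max_left _ _) (by positivity)).trans_lt h
  have h2 : Real.log (2 * (Nat.card (Copies F a b) : ℝ)) < ε ^ 2 * c / 64 := by
    have he : 0 < ε ^ 2 / 64 := by positivity
    calc _ = ε ^ 2 / 64 * (64 * (ε ^ 2)⁻¹ * Real.log (2 * (Nat.card (Copies F a b) : ℝ))) := by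
          field_simp
      _ < ε ^ 2 / 64 * c := mul_lt_mul_of_pos_left h1 he
      _ = _ := by ring
  have h3 : 0 < ε ^ 2 * c := by positivity
  -- The constant 64 leaves a factor 2 to spare over the 32 needed.
  linarith

theorem ramseyBound_le_explicitBound (ha : 0 < a) (hb : 0 < b) (hab : a ∣ b) (ε : ℝ) :
    ramseyBound F a b ε ≤ explicitBound F b ε := by
  have : Nonempty (Copies F a b) := Copies.nonempty_of_dvd ha hb hab
  have hk : (0 : ℝ) < Nat.card (Copies F a b) := by exact_mod_cast Nat.card_pos
  refine mul_le_mul_of_nonneg_left (max_le ?_ ?_) (by positivity)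
  · rw [Real.log_mul two_ne_zero hk.ne']
    gcongr
    refine le_max_of_le_left ?_
    have h := Real.log_le_log hk
      (show (Nat.card (Copies F a b) : ℝ) ≤ (Nat.card F : ℝ) ^ b ^ 2 by
        exact_mod_cast card_copies_le ha)
    rw [Real.log_pow] at h
    exact_mod_cast h
  · exact le_add_of_nonneg_of_le (Real.log_nonneg one_le_two) (le_max_right _ _)

theorem approxRamsey_of_not_dvd (ha : 0 < a) (hab : ¬ a ∣ b) {ε : ℝ} (hε : 0 < ε) :
    ApproxRamsey F a b b ε := by
  intro γ _
  have : IsEmpty (Copies F a b) := ⟨fun S => hab (S.dvd ha)⟩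
  refine ⟨Copies.range (AlgHom.id F _) Function.injective_id, ?_⟩
  rw [oscillation, Set.eq_empty_of_isEmpty (copiesIn a _), Set.image_empty, Metric.diam_empty]
  exact hε.le

end Ramsey

end MatrixRamsey

theorem mainTheorem4 (F : Type*) [Field F] [Finite F] (a b : ℕ) (ha : 0 < a) (hb : 0 < b)
    (ε : ℝ) (hε : 0 < ε) :
    (∃ c : ℕ, 0 < c ∧ MatrixRamsey.ApproxRamsey F a b c ε) ∧
    (a ∣ b →
      (∀ c : ℕ, b ∣ c → MatrixRamsey.ramseyBound F a b ε < c →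
        MatrixRamsey.ApproxRamsey F a b c ε) ∧
      Nat.card (MatrixRamsey.Copies F a b) ≤ Nat.card F ^ b ^ 2 ∧
      MatrixRamsey.ramseyBound F a b ε ≤ MatrixRamsey.explicitBound F b ε ∧
      (∀ c : ℕ, b ∣ c → MatrixRamsey.explicitBound F b ε < c →
        MatrixRamsey.ApproxRamsey F a b c ε)) := by
  refine ⟨?_, fun hab => ⟨fun c hbc h =>
    MatrixRamsey.approxRamsey_of_ramseyBound_lt ha hb hε hbc h, MatrixRamsey.card_copies_le ha,
    MatrixRamsey.ramseyBound_le_explicitBound ha hb hab ε, fun c hbc h =>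
    MatrixRamsey.approxRamsey_of_ramseyBound_lt ha hb hε hbc
      ((MatrixRamsey.ramseyBound_le_explicitBound ha hb hab ε).trans_lt h)⟩⟩
  by_cases hab : a ∣ b
  · obtain ⟨N, hN⟩ := exists_nat_gt (MatrixRamsey.ramseyBound F a b ε)
    have hN0 : 0 < N := by
      exact_mod_cast (MatrixRamsey.ramseyBound_nonneg (F := F) (a := a) (b := b) ε).trans_lt hN
    -- Multiplying by $b$ makes $c$ a multiple of $b$ and keeps it above the bound.
    refine ⟨b * N, Nat.mul_pos hb hN0,
      MatrixRamsey.approxRamsey_of_ramseyBound_lt ha hb hε (dvd_mul_right b N)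
        (hN.trans_le ?_)⟩
    exact_mod_cast Nat.le_mul_of_pos_left N hb
  · exact ⟨b, hb, MatrixRamsey.approxRamsey_of_not_dvd ha hab hε⟩
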